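/- Let $d\in\mathbb N$ and write $A\Subset\mathbb Z^d$ for a finite subset. For each $v\in\mathbb Z^d$ let $M_v\ge 1$ be a real number (mass), let $\psi_v$ be a probability distribution on $\mathbb N=\{0,1,2,\dots\}$ with $\psi_v(0)>0$, and let $(S_v(l))_{l\ge 1}$ be a sequence of finite subsets of $\mathbb Z^d$. Let $(D_n)_{n\in\mathbb N}$ be a homogeneous Markov chain on the countable set $\{A : A\Subset\mathbb Z^d\}$, with arbitrary initial law, whose transitions are as follows. If $D_n=\emptyset$, then $D_{n+1}=\emptyset$. If $D_n=A\ne\emptyset$, a vertex $w\in A$ is selected with probability $M_w/\sum_{z\in A}M_z$, then a value $k\in\mathbb N$ is drawn with probability $\psi_w(k)$; if $k=0$ then $D_{n+1}=A\setminus\{w\}$, and if $k\ge1$ then $D_{n+1}=A\cup S_w(k)$. Put $$\eta_v=-\psi_v(0)+\sum_{l=1}^{\infty}|S_v(l)|\,\psi_v(l),$$ and assume that $\eta_v<\infty$ for every $v\in\mathbb Z^d$. If $$\lim_{\Lambda\uparrow\mathbb Z^d}\ \sup_{v\notin\Lambda}\eta_v<0,$$ where the limit is taken along the finite subsets $\Lambda\Subset\mathbb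 Z^d$ directed by inclusion, then almost surely $\limsup_{n\to\infty}D_n=\emptyset$; more precisely, almost surely there is a (random) $m\in\mathbb N$ such that $D_n=\emptyset$ for all $n\ge m$. -/

import Mathlib

open MeasureTheory Filter Topology
open scoped ENNReal

namespace Extinction

/-- `D` is, under `P`, a homogeneous Markov chain on the countable discrete state space `E`
with initial law `ν` and transition probabilities `p x y`. The Markov property is written with
the conditional probabilities multiplied out:
`P(D₀ = x₀, …, Dₙ₊₁ = xₙ₊₁) = P(D₀ = x₀, …, Dₙ = xₙ) * p xₙ xₙ₊₁`. -/
structure IsMarkovChain {Ω E : Type*} [MeasurableSpace Ω] [Countable E] (P : Measure Ω)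
    (ν : PMF E) (p : E → E → ℝ≥0∞) (D : ℕ → Ω → E) : Prop where
  measurableSet_eq : ∀ n x, MeasurableSet {ω | D n ω = x}
  initial : ∀ x, P {ω | D 0 ω = x} = ν x
  step : ∀ (n : ℕ) (x : ℕ → E),
    P {ω | ∀ i ≤ n + 1, D i ω = x i} = P {ω | ∀ i ≤ n, D i ω = x i} * p (x n) (x (n + 1))

variable {V : Type*} [DecidableEq V]

/-- The set that follows `A` once the vertex `w ∈ A` has been selected and the value `k` has been
drawn: `A \ {w}` if `k = 0`, and `A ∪ S_w(k)` if `k ≥ 1`. -/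
def update (S : V → ℕ+ → Finset V) (A : Finset V) (w : V) : ℕ → Finset V
  | 0 => A.erase w
  | l + 1 => A ∪ S w l.succPNat

/-- The probability of selecting the vertex `w ∈ A`, proportionally to its mass. -/
noncomputable def selectProb (M : V → ℝ) (A : Finset V) (w : V) : ℝ≥0∞ :=
  ENNReal.ofReal (M w / ∑ z ∈ A, M z)

/-- The transition probability from `A` to `B`: the empty set is absorbing; from a nonempty `A`
a vertex `w ∈ A` is selected proportionally to its mass, a value `k` is drawn from `ψ w`, and the
next set is `update S A w k`. -/
noncomputable def transProb (M : V → ℝ) (ψ : V → PMF ℕ) (S : V → ℕ+ → Finset V)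
    (A B : Finset V) : ℝ≥0∞ :=
  if A = ∅ then (if B = ∅ then 1 else 0)
  else ∑ w ∈ A, selectProb M A w * ∑' k : ℕ, if update S A w k = B then ψ w k else 0

/-- `η_v = -ψ_v(0) + ∑_{l ≥ 1} |S_v(l)| ψ_v(l)`, with values in the extended reals: it is `⊤`
exactly when the series diverges. -/
noncomputable def eta (ψ : V → PMF ℕ) (S : V → ℕ+ → Finset V) (v : V) : EReal :=
  -((ψ v 0 : ℝ≥0∞) : EReal) + ((∑' l : ℕ+, ((S v l).card : ℝ≥0∞) * ψ v l : ℝ≥0∞) : EReal)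

end Extinction

/-!
The number `|A|` of vertices is a Foster-Lyapunov function for the chain. If the vertex `w` is
selected from `A`, then `|A|` changes on average by at most `η_w`, which is at most `-ε` outside a
finite set `Λ` of vertices. As all masses are at least `1`, the vertices of `Λ` are selected from
`A` with probability `O(1 / |A|)`, so that `|A|` decreases on average by at least `ε / 2` as soon
as `|A| > K`, for some `K` (`exists_drift`). Hence the chain returns to the sets of at most `K`
vertices. The draws are `0` with probability at least some `δ > 0`, uniformly in the vertex, since
`η_w ≤ -ε` forces `ψ_w(0) ≥ ε`; so from a set of at most `K` vertices the chain dies out within `K`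
steps with probability at least `δ ^ K` (`add_pow_mul_le_of_card_le`).

The two facts are combined without stopping times. The probability `u(A)` of surviving forever from
`A` is subharmonic. Let `s` be its supremum. Then `u ≤ b` with `b = (1 - δ ^ K) s` on the sets of at
most `K` vertices, and the function `(u - b)⁺`, which is subharmonic and is zero there, has to
vanish everywhere by a maximum principle (`eq_zero_of_le_transOp_of_drift`). So `s ≤ (1 - δ ^ K) s`
and `s = 0`. As the empty set is absorbing, the chain is eventually empty almost surely.
-/

namespace Extinction

/-! ### Transition operators and a maximum principle -/

section MarkovOperator

variable {E : Type*}

/-- The transition operator `f ↦ (x ↦ ∑ y, p x y * f y)` on functions with values in `[0, ∞]`. -/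
noncomputable def transOp (p : E → E → ℝ≥0∞) (f : E → ℝ≥0∞) (x : E) : ℝ≥0∞ :=
  ∑' y, p x y * f y

theorem transOp_mono (p : E → E → ℝ≥0∞) : Monotone (transOp p) := fun _ _ h x =>
  ENNReal.tsum_le_tsum fun y => mul_le_mul_right (h y) (p x y)

/-- Monotone convergence from above for a weighted sum of functions bounded by `1`. -/
theorem iInf_tsum_mul {a : E → ℝ≥0∞} (ha : ∑' y, a y ≠ ⊤) {g : ℕ → E → ℝ≥0∞}
    (hg : Antitone g) (hg1 : ∀ y, g 0 y ≤ 1) :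
    ⨅ n, ∑' y, a y * g n y = ∑' y, a y * ⨅ n, g n y := by
  -- Weighted sums are integrals against the counting measure of the discrete σ-algebra.
  let _ : MeasurableSpace E := ⊤
  have hay : ∀ y, a y ≠ ⊤ := fun y => ENNReal.ne_top_of_tsum_ne_top ha y
  have key := MeasureTheory.lintegral_iInf (μ := Measure.count) (f := fun n y => a y * g n y)
    (fun n => measurable_from_top)
    (fun m n h y => mul_le_mul_right (hg h y) (a y)) (by
      simp only [lintegral_count]
      exact ne_top_of_le_ne_top ha (ENNReal.tsum_le_tsum fun y => mul_le_of_le_one_right' (hg1 y)))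
  simp only [lintegral_count] at key
  rw [← key]
  exact tsum_congr fun y =>
    (ENNReal.mul_iInf' (fun h => absurd h (hay y)) fun _ => inferInstance).symm

/-- The limit of a decreasing sequence of iterates of the transition operator is subharmonic. -/
theorem iInf_iterate_le_transOp {p : E → E → ℝ≥0∞} (hp : ∀ x, ∑' y, p x y ≤ 1)
    {f : E → ℝ≥0∞} (hf1 : ∀ y, f y ≤ 1) (hf : Antitone fun n => (transOp p)^[n] f) (x : E) :
    ⨅ n, (transOp p)^[n] f x ≤ transOp p (fun y => ⨅ n, (transOp p)^[n] f y) x := by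
  rw [transOp, ← iInf_tsum_mul (ne_top_of_le_ne_top ENNReal.one_ne_top (hp x)) hf hf1]
  refine le_iInf fun n => (iInf_le _ (n + 1)).trans ?_
  rw [Function.iterate_succ_apply']
  rfl

theorem transOp_add_const_le {p : E → E → ℝ≥0∞} (hp : ∀ x, ∑' y, p x y ≤ 1)
    (f : E → ℝ≥0∞) (b : ℝ≥0∞) (x : E) :
    transOp p (fun y => f y + b) x ≤ transOp p f x + b := by
  simp only [transOp, mul_add, ENNReal.tsum_add, ENNReal.tsum_mul_right]
  gcongr
  exact mul_le_of_le_one_left' (hp x)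

theorem transOp_const_mul (p : E → E → ℝ≥0∞) (f : E → ℝ≥0∞) (a : ℝ≥0∞) (x : E) :
    transOp p (fun y => a * f y) x = a * transOp p f x := by
  simp only [transOp, mul_left_comm _ a, ENNReal.tsum_mul_left]

/-- A maximum principle. If `W` decreases on average by at least `c > 0` in each step from a state
outside `F`, then a function `v ≤ 1` that vanishes on `F` and is subharmonic outside `F` is zero. -/
theorem eq_zero_of_le_transOp_of_drift {p : E → E → ℝ≥0∞} {W v : E → ℝ≥0∞} {c : ℝ≥0∞}
    (hc0 : c ≠ 0) (F : Set E) (hW : ∀ x, W x ≠ ⊤)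
    (hdrift : ∀ x ∉ F, transOp p W x + c ≤ W x)
    (hv1 : ∀ x, v x ≤ 1) (hvF : ∀ x ∈ F, v x = 0) (hv : ∀ x ∉ F, v x ≤ transOp p v x) (x : E) :
    v x = 0 := by
  -- Since `v ≤ 1`, the drift of `W` pays for one more copy of `c * v` in each step.
  have hbound : ∀ n : ℕ, ∀ x, c * n * v x ≤ W x := by
    intro n
    induction n with
    | zero => simp
    | succ n ih =>
      intro x
      by_cases hx : x ∈ F
      · simp [hvF x hx]
      calc c * (n + 1 : ℕ) * v x = c * n * v x + c * v x := by push_cast; ring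
        _ ≤ c * n * transOp p v x + c * 1 := by
          gcongr
          exacts [hv x hx, hv1 x]
        _ = transOp p (fun y => c * n * v y) x + c := by rw [transOp_const_mul, mul_one]
        _ ≤ transOp p W x + c := by gcongr; exact transOp_mono p ih x
        _ ≤ W x := hdrift x hx
  by_contra h
  obtain ⟨n, hn⟩ := ENNReal.exists_nat_mul_gt (mul_ne_zero hc0 h) (hW x)
  exact absurd (hbound n x) (not_le.2 (by rwa [mul_comm c, mul_assoc]))

end MarkovOperator

/-! ### Laws of a Markov chain and absorption -/

section MarkovChain

variable {Ω E : Type*} [MeasurableSpace Ω] [Countable E] {P : Measure Ω} {ν : PMF E}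
  {p : E → E → ℝ≥0∞} {D : ℕ → Ω → E}

/-- The Markov property for the joint law at two consecutive times. -/
theorem IsMarkovChain.measure_eq_inter (hD : IsMarkovChain P ν p D) (n : ℕ) (x y : E) :
    P ({ω | D n ω = x} ∩ {ω | D (n + 1) ω = y}) = P {ω | D n ω = x} * p x y := by
  -- The trajectory that follows `g` before time `n`, is at `x` at time `n` and at `y` afterwards.
  let c : (Fin n → E) → ℕ → E := fun g i =>
    if h : i < n then g ⟨i, h⟩ else if i = n then x else y
  have hc : ∀ g (i : Fin n), c g i = g i := fun g i => by simp [c]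
  have hcn : ∀ g, c g n = x := fun g => by simp [c]
  have hcn1 : ∀ g, c g (n + 1) = y := fun g => by simp [c]
  have hmeas : ∀ m g, MeasurableSet {ω | ∀ i ≤ m, D i ω = c g i} := fun m g => by
    simp only [Set.ofPred_forall]
    exact MeasurableSet.iInter fun i => MeasurableSet.iInter fun _ => hD.measurableSet_eq i _
  have hdisj : ∀ m, n ≤ m →
      Pairwise (Function.onFun Disjoint fun g => {ω | ∀ i ≤ m, D i ω = c g i}) := by
    intro m hm g g' hgg
    refine Set.disjoint_left.2 fun ω h h' => hgg (funext fun i => ?_)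
    have hi : (i : ℕ) ≤ m := i.2.le.trans hm
    rw [← hc g i, ← hc g' i, ← h i hi, ← h' i hi]
  have hn : {ω | D n ω = x} = ⋃ g, {ω | ∀ i ≤ n, D i ω = c g i} := by
    ext ω
    simp only [Set.mem_ofPred_eq, Set.mem_iUnion]
    constructor
    · intro h
      refine ⟨fun i => D i ω, fun i hi => ?_⟩
      rcases hi.lt_or_eq with hi | rfl
      · simp [c, hi]
      · simp [c, h]
    · rintro ⟨g, hg⟩
      rw [hg n le_rfl, hcn]
  have hn1 : {ω | D n ω = x} ∩ {ω | D (n + 1) ω = y} =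
      ⋃ g, {ω | ∀ i ≤ n + 1, D i ω = c g i} := by
    ext ω
    simp only [Set.mem_inter_iff, Set.mem_ofPred_eq, Set.mem_iUnion]
    constructor
    · rintro ⟨h, h1⟩
      refine ⟨fun i => D i ω, fun i hi => ?_⟩
      rcases hi.lt_or_eq with hi | rfl
      · rcases (Nat.lt_succ_iff.1 hi).lt_or_eq with hi | rfl
        · simp [c, hi]
        · simp [c, h]
      · simp [c, h1]
    · rintro ⟨g, hg⟩
      rw [hg n (Nat.le_succ n), hcn, hg (n + 1) le_rfl, hcn1]
      exact ⟨rfl, rfl⟩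
  rw [hn1, hn, measure_iUnion (hdisj _ (Nat.le_succ n)) (hmeas _), measure_iUnion (hdisj _ le_rfl)
    (hmeas _), ← ENNReal.tsum_mul_right]
  exact tsum_congr fun g => by rw [hD.step, hcn, hcn1]

theorem IsMarkovChain.tsum_measure_inter (hD : IsMarkovChain P ν p D) (n : ℕ) {s : Set Ω} :
    ∑' x, P ({ω | D n ω = x} ∩ s) = P s := by
  have h := measure_iUnion (μ := P.restrict s) (f := fun x => {ω | D n ω = x})
    (fun x y hxy => Set.disjoint_left.2 fun ω h h' => hxy (h.symm.trans h'))
    (hD.measurableSet_eq n)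
  have hU : ⋃ x, {ω | D n ω = x} = Set.univ := by ext ω; simp
  rw [hU, Measure.restrict_apply_univ] at h
  rw [h]
  exact tsum_congr fun x => (Measure.restrict_apply (hD.measurableSet_eq n x)).symm

theorem IsMarkovChain.measure_succ_eq (hD : IsMarkovChain P ν p D) (n : ℕ) (y : E) :
    P {ω | D (n + 1) ω = y} = ∑' x, P {ω | D n ω = x} * p x y := by
  rw [← hD.tsum_measure_inter n]
  exact tsum_congr fun x => hD.measure_eq_inter n x y

/-- The expectation of `f (D n)`, computed from the initial law. -/
theorem IsMarkovChain.tsum_measure_mul (hD : IsMarkovChain P ν p D) (n : ℕ) (f : E → ℝ≥0∞) :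
    ∑' x, P {ω | D n ω = x} * f x = ∑' x, ν x * (transOp p)^[n] f x := by
  induction n generalizing f with
  | zero => simp [hD.initial]
  | succ n ih =>
    rw [Function.iterate_succ_apply, ← ih]
    simp only [hD.measure_succ_eq, transOp, ← ENNReal.tsum_mul_left, ← ENNReal.tsum_mul_right]
    rw [ENNReal.tsum_comm]
    simp only [mul_assoc]

/-- A chain reaches the absorbing state `a` almost surely, and stays there, as soon as the
probability of having avoided it until time `n` tends to `0` from every initial state. -/
theorem IsMarkovChain.ae_eventually_eq (hD : IsMarkovChain P ν p D) {a : E}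
    (ha : ∀ y ≠ a, p a y = 0)
    (hanti : Antitone fun n => (transOp p)^[n] (({a}ᶜ : Set E).indicator 1))
    (hlim : ∀ x, ⨅ n, (transOp p)^[n] (({a}ᶜ : Set E).indicator 1) x = 0) :
    ∀ᵐ ω ∂P, ∃ m, ∀ n ≥ m, D n ω = a := by
  have hstay : ∀ᵐ ω ∂P, ∀ n, D n ω = a → D (n + 1) ω = a := by
    refine ae_all_iff.2 fun n => ?_
    have : ∀ᵐ ω ∂P, ∀ y, y ≠ a → ¬ (D n ω = a ∧ D (n + 1) ω = y) := by
      refine ae_all_iff.2 fun y => ?_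
      by_cases hy : y = a
      · simp [hy]
      have h0 := hD.measure_eq_inter n a y
      rw [ha y hy, mul_zero] at h0
      filter_upwards [measure_eq_zero_iff_ae_notMem.1 h0] with ω hω _ using hω
    filter_upwards [this] with ω hω hn
    by_contra hne
    exact hω _ hne ⟨hn, rfl⟩
  have hhit : ∀ᵐ ω ∂P, ∃ n, D n ω = a := by
    have hle : ∀ n, P {ω | ¬ ∃ n, D n ω = a} ≤
        ∑' x, ν x * (transOp p)^[n] (({a}ᶜ : Set E).indicator 1) x := by
      intro n
      rw [← hD.tsum_measure_mul, ← hD.tsum_measure_inter n]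
      refine ENNReal.tsum_le_tsum fun x => ?_
      by_cases hx : x = a
      · subst hx
        refine le_of_eq_of_le (measure_mono_null (t := ∅) ?_ measure_empty) zero_le
        rintro ω ⟨h, h'⟩
        exact h' ⟨n, h⟩
      · simpa [hx] using measure_mono Set.inter_subset_left
    refine ae_iff.2 (le_antisymm ?_ zero_le)
    refine (le_iInf hle).trans ?_
    rw [iInf_tsum_mul (by rw [ν.tsum_coe]; exact ENNReal.one_ne_top) hanti]
    · simp [hlim]
    · exact fun y => Set.indicator_le_self' (by simp) y
  filter_upwards [hstay, hhit] with ω hω ⟨m, hm⟩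
  refine ⟨m, fun n hn => ?_⟩
  induction n, hn using Nat.le_induction with
  | base => exact hm
  | succ n _ ih => exact hω n ih

end MarkovChain

/-! ### The mean growth `η` -/

section Eta

variable {V : Type*} {ψ : V → PMF ℕ} {S : V → ℕ+ → Finset V}

theorem tsum_ne_top_of_eta_lt_top {v : V} (h : eta ψ S v < ⊤) :
    ∑' l : ℕ+, ((S v l).card : ℝ≥0∞) * ψ v l ≠ ⊤ := by
  intro htop
  rw [eta, htop] at h
  lift (ψ v 0 : ℝ≥0∞) to NNReal using (ψ v).apply_ne_top 0 with a
  simp at h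

theorem tsum_add_le_of_eta_le {v : V} {r : ℝ} (hr : r ≤ 0) (h : eta ψ S v ≤ r) :
    ∑' l : ℕ+, ((S v l).card : ℝ≥0∞) * ψ v l + ENNReal.ofReal (-r) ≤ ψ v 0 := by
  have hR := tsum_ne_top_of_eta_lt_top (h.trans_lt (EReal.coe_lt_top r))
  rw [eta] at h
  generalize ∑' l : ℕ+, ((S v l).card : ℝ≥0∞) * ψ v l = R at h hR
  lift (ψ v 0 : ℝ≥0∞) to NNReal using (ψ v).apply_ne_top 0 with a
  lift R to NNReal using hR
  rw [EReal.coe_nnreal_eq_coe_real, EReal.coe_nnreal_eq_coe_real] at h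
  have h' : -(a : ℝ) + R ≤ r := by exact_mod_cast h
  rw [← ENNReal.ofReal_coe_nnreal, ← ENNReal.ofReal_coe_nnreal (p := a),
    ← ENNReal.ofReal_add R.coe_nonneg (by linarith)]
  exact ENNReal.ofReal_le_ofReal (by linarith)

end Eta

/-! ### The transition probabilities of the set-valued chain -/

section Transition

variable {V : Type*} {M : V → ℝ} {A : Finset V}

theorem sum_selectProb (hM : ∀ v, 1 ≤ M v) (hA : A.Nonempty) :
    ∑ w ∈ A, selectProb M A w = 1 := by
  have hpos : ∀ v, 0 < M v := fun v => one_pos.trans_le (hM v)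
  have hsum : 0 < ∑ z ∈ A, M z := Finset.sum_pos (fun v _ => hpos v) hA
  simp only [selectProb]
  rw [← ENNReal.ofReal_sum_of_nonneg fun v _ => div_nonneg (hpos v).le hsum.le,
    ← Finset.sum_div, div_self hsum.ne', ENNReal.ofReal_one]

/-- All masses are at least `1`, so that the total mass of `A` is at least `|A|`. -/
theorem card_mul_selectProb_le (hM : ∀ v, 1 ≤ M v) (hA : A.Nonempty) (w : V) :
    A.card * selectProb M A w ≤ ENNReal.ofReal (M w) := by
  have hcard : (A.card : ℝ) ≤ ∑ z ∈ A, M z := by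
    simpa using Finset.sum_le_sum fun z (_ : z ∈ A) => hM z
  have hA0 : (0 : ℝ) < A.card := by exact_mod_cast hA.card_pos
  rw [selectProb, ← ENNReal.ofReal_natCast, ← ENNReal.ofReal_mul hA0.le]
  refine ENNReal.ofReal_le_ofReal ?_
  rw [← mul_div_assoc, div_le_iff₀ (hA0.trans_le hcard), mul_comm]
  exact mul_le_mul_of_nonneg_left hcard (zero_le_one.trans (hM w))

variable [DecidableEq V] {ψ : V → PMF ℕ} {S : V → ℕ+ → Finset V}

/-- The mean of `f` over the sets that follow `A` when `w` has been selected. -/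
noncomputable def updateMean (ψ : V → PMF ℕ) (S : V → ℕ+ → Finset V) (f : Finset V → ℝ≥0∞)
    (A : Finset V) (w : V) : ℝ≥0∞ :=
  ∑' k, ψ w k * f (update S A w k)

theorem updateMean_eq (f : Finset V → ℝ≥0∞) (w : V) :
    updateMean ψ S f A w =
      ψ w 0 * f (A.erase w) + ∑' l : ℕ+, ψ w l * f (A ∪ S w l) := by
  rw [updateMean, tsum_eq_zero_add' ENNReal.summable]
  congr 1
  exact Equiv.pnatEquivNat.symm.tsum_eq fun l : ℕ+ => ψ w l * f (A ∪ S w l)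

theorem transOp_transProb (hA : A.Nonempty) (f : Finset V → ℝ≥0∞) :
    transOp (transProb M ψ S) f A = ∑ w ∈ A, selectProb M A w * updateMean ψ S f A w := by
  simp only [transOp, transProb, if_neg hA.ne_empty, Finset.sum_mul]
  rw [Summable.tsum_finsetSum fun _ _ => ENNReal.summable]
  refine Finset.sum_congr rfl fun w _ => ?_
  simp only [mul_assoc, ENNReal.tsum_mul_left, ← ENNReal.tsum_mul_right]
  rw [ENNReal.tsum_comm, updateMean]
  congr 1
  refine tsum_congr fun k => ?_
  rw [tsum_eq_single (update S A w k) fun B hB => by simp [hB.symm]]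
  simp

theorem transOp_transProb_empty (f : Finset V → ℝ≥0∞) :
    transOp (transProb M ψ S) f ∅ = f ∅ := by
  rw [transOp, tsum_eq_single ∅ fun B hB => by simp [transProb, hB]]
  simp [transProb]

/-- A bound for the mean over one step from bounds for each selected vertex. -/
theorem transOp_transProb_add_le (hM : ∀ v, 1 ≤ M v) (hA : A.Nonempty) {f : Finset V → ℝ≥0∞}
    {c : ℝ≥0∞} {g : V → ℝ≥0∞} (h : ∀ w ∈ A, updateMean ψ S f A w + c ≤ g w) :
    transOp (transProb M ψ S) f A + c ≤ ∑ w ∈ A, selectProb M A w * g w := by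
  rw [transOp_transProb hA]
  nth_rewrite 1 [← one_mul c]
  rw [← sum_selectProb hM hA, Finset.sum_mul, ← Finset.sum_add_distrib]
  simp only [← mul_add]
  exact Finset.sum_le_sum fun w hw => mul_le_mul_right (h w hw) _

theorem tsum_transProb (hM : ∀ v, 1 ≤ M v) (A : Finset V) :
    ∑' B, transProb M ψ S A B = 1 := by
  have h : ∑' B, transProb M ψ S A B = transOp (transProb M ψ S) 1 A := by simp [transOp]
  rw [h]
  rcases A.eq_empty_or_nonempty with rfl | hA
  · rw [transOp_transProb_empty, Pi.one_apply]
  · simp [transOp_transProb hA, updateMean, sum_selectProb hM hA]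

/-- When `w` is selected, the mean number of new vertices is at most `∑ |S_w(l)| ψ_w(l)`. -/
theorem updateMean_card_add_le {w : V} (hw : w ∈ A) :
    updateMean ψ S (fun B => (B.card : ℝ≥0∞)) A w + ψ w 0 ≤
      A.card + ∑' l : ℕ+, ((S w l).card : ℝ≥0∞) * ψ w l := by
  have hψ : (A.card : ℝ≥0∞) = ψ w 0 * A.card + ∑' l : ℕ+, ψ w l * A.card := by
    have := updateMean_eq (ψ := ψ) (S := S) (A := A) (fun _ => (A.card : ℝ≥0∞)) w
    rwa [updateMean, ENNReal.tsum_mul_right, PMF.tsum_coe, one_mul] at this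
  have herase : ((A.erase w).card : ℝ≥0∞) + 1 = A.card := by
    exact_mod_cast Finset.card_erase_add_one hw
  calc updateMean ψ S (fun B => (B.card : ℝ≥0∞)) A w + ψ w 0
      = ψ w 0 * A.card + ∑' l : ℕ+, ψ w l * (A ∪ S w l).card := by
        rw [updateMean_eq, ← herase]; ring
    _ ≤ ψ w 0 * A.card + ∑' l : ℕ+, (ψ w l * A.card + (S w l).card * ψ w l) := by
        gcongr with l
        rw [mul_comm ((S w l).card : ℝ≥0∞), ← mul_add]
        gcongr
        exact_mod_cast Finset.card_union_le _ _
    _ = A.card + ∑' l : ℕ+, ((S w l).card : ℝ≥0∞) * ψ w l := by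
        rw [ENNReal.tsum_add, ← add_assoc, ← hψ]

/-! ### Extinction -/

/-- From a set of at most `j` vertices, the next `j` draws are all `0` with probability at least
`δ ^ j`, whichever vertices are selected. Hence a subharmonic function that is bounded by `s` and
vanishes at the empty set is at most `(1 - δ ^ j) s` at such a set. -/
theorem add_pow_mul_le_of_card_le (hM : ∀ v, 1 ≤ M v) {δ : ℝ≥0∞} (hδ1 : δ ≤ 1)
    (hδ : ∀ v, δ ≤ ψ v 0) {u : Finset V → ℝ≥0∞} {s : ℝ≥0∞}
    (hu : ∀ A, u A ≤ transOp (transProb M ψ S) u A) (hu0 : u ∅ = 0) (hus : ∀ A, u A ≤ s)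
    (j : ℕ) (A : Finset V) (hAj : A.card ≤ j) :
    u A + δ ^ j * s ≤ s := by
  induction j generalizing A with
  | zero => simp_all
  | succ j ih =>
    rcases A.eq_empty_or_nonempty with rfl | hA
    · rw [hu0, zero_add]
      exact mul_le_of_le_one_left' (pow_le_one₀ zero_le hδ1)
    calc u A + δ ^ (j + 1) * s ≤ transOp (transProb M ψ S) u A + δ ^ (j + 1) * s := by
          gcongr; exact hu A
      _ ≤ ∑ w ∈ A, selectProb M A w * s := transOp_transProb_add_le hM hA fun w hw => ?_
      _ = s := by rw [← Finset.sum_mul, sum_selectProb hM hA, one_mul]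
    have hcard : (A.erase w).card ≤ j := by
      rw [Finset.card_erase_of_mem hw]; omega
    -- Bound `u` by the induction hypothesis after a draw of `0`, and by `s` after any other draw.
    have hψ : s = ψ w 0 * s + ∑' l : ℕ+, ψ w l * s := by
      have := updateMean_eq (ψ := ψ) (S := S) (A := A) (fun _ => s) w
      rwa [updateMean, ENNReal.tsum_mul_right, PMF.tsum_coe, one_mul] at this
    calc updateMean ψ S u A w + δ ^ (j + 1) * s
        ≤ updateMean ψ S u A w + ψ w 0 * (δ ^ j * s) := by
          rw [pow_succ', mul_assoc]; gcongr; exact hδ w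
      _ = ψ w 0 * (u (A.erase w) + δ ^ j * s) + ∑' l : ℕ+, ψ w l * u (A ∪ S w l) := by
          rw [updateMean_eq]; ring
      _ ≤ ψ w 0 * s + ∑' l : ℕ+, ψ w l * s := by
          gcongr
          exacts [ih _ hcard, hus _]
      _ = s := hψ.symm

/-- The `n`-th iterate is the probability, as a function of the initial set, that the process has
not died out until time `n`. -/
theorem antitone_iterate_transOp (hM : ∀ v, 1 ≤ M v) :
    Antitone fun n => (transOp (transProb M ψ S))^[n] (({∅}ᶜ : Set (Finset V)).indicator 1) := by
  refine (transOp_mono _).antitone_iterate_of_map_le fun A => ?_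
  rcases A.eq_empty_or_nonempty with rfl | hA
  · rw [transOp_transProb_empty]
  · have h1 : ({∅}ᶜ : Set (Finset V)).indicator (1 : Finset V → ℝ≥0∞) ≤ 1 :=
      Set.indicator_le_self' (by simp)
    refine (transOp_mono _ h1 A).trans ?_
    simp [transOp, tsum_transProb hM, hA.ne_empty]

/-- The process dies out from every initial set if `|A|` decreases on average by at least `c > 0`
in each step from a set `A` of more than `K` vertices, and every draw is `0` with probability at
least `δ > 0`. -/
theorem iInf_iterate_transOp_eq_zero (hM : ∀ v, 1 ≤ M v) {δ : ℝ≥0∞} (hδ0 : δ ≠ 0)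
    (hδ1 : δ ≤ 1) (hδ : ∀ v, δ ≤ ψ v 0) {c : ℝ≥0∞} (hc : c ≠ 0) (K : ℕ)
    (hdrift : ∀ A : Finset V, K < A.card →
      transOp (transProb M ψ S) (fun B => (B.card : ℝ≥0∞)) A + c ≤ A.card)
    (A : Finset V) :
    ⨅ n, (transOp (transProb M ψ S))^[n] (({∅}ᶜ : Set (Finset V)).indicator 1) A = 0 := by
  set T := transOp (transProb M ψ S)
  set f : Finset V → ℝ≥0∞ := ({∅}ᶜ : Set (Finset V)).indicator 1
  have hf1 : ∀ B, f B ≤ 1 := fun B => Set.indicator_le_self' (by simp) B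
  have hp : ∀ B, ∑' B', transProb M ψ S B B' ≤ 1 := fun B => (tsum_transProb hM B).le
  -- The probability of surviving forever, as a function of the initial set.
  set u : Finset V → ℝ≥0∞ := fun B => ⨅ n, T^[n] f B
  have hu : ∀ B, u B ≤ T u B := iInf_iterate_le_transOp hp hf1 (antitone_iterate_transOp hM)
  have hu1 : ∀ B, u B ≤ 1 := fun B => (iInf_le _ 0).trans (hf1 B)
  have hu0 : u ∅ = 0 := le_antisymm ((iInf_le _ 0).trans (by simp [f])) zero_le
  set s := ⨆ B, u B
  have hus : ∀ B, u B ≤ s := le_iSup u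
  have hs : s ≠ ⊤ := ne_top_of_le_ne_top ENNReal.one_ne_top (iSup_le hu1)
  have hqs : δ ^ K * s ≠ ⊤ := ENNReal.mul_ne_top
    (ENNReal.pow_ne_top (ne_top_of_le_ne_top ENNReal.one_ne_top hδ1)) hs
  set b := s - δ ^ K * s
  -- Subtraction is truncated: `u - b` is the positive part, which is again subharmonic.
  have hv : ∀ B, u B - b = 0 := by
    refine eq_zero_of_le_transOp_of_drift (p := transProb M ψ S) hc
      {B | B.card ≤ K} (W := fun B => (B.card : ℝ≥0∞)) (fun B => ENNReal.natCast_ne_top _)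
      (fun B hB => hdrift B (not_le.1 hB)) (fun B => tsub_le_self.trans (hu1 B)) ?_ ?_
    · intro B hB
      exact tsub_eq_zero_of_le
        (ENNReal.le_sub_of_add_le_right hqs (add_pow_mul_le_of_card_le hM hδ1 hδ hu hu0 hus K B hB))
    · intro B _
      rw [tsub_le_iff_right]
      calc u B ≤ T u B := hu B
        _ ≤ T (fun B => u B - b + b) B := transOp_mono _ (fun B => le_tsub_add) B
        _ ≤ T (fun B => u B - b) B + b := transOp_add_const_le hp _ b B
  have hsb : s ≤ b := iSup_le fun B => tsub_eq_zero_iff_le.1 (hv B)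
  have hs0 : s = 0 := by
    by_contra h0
    exact absurd hsb (not_le.2 (ENNReal.sub_lt_self hs h0 (mul_ne_zero (pow_ne_zero K hδ0) h0)))
  exact le_antisymm ((hus A).trans hs0.le) zero_le

/-- The negative drift of `|A|`. A vertex of the finite set `Λ` is selected from `A` with
probability at most `∑_{w ∈ Λ} M_w / |A|`, so that for large `A` the growth it may cause is
outweighed by the mean loss of at least `ε` at the other vertices. -/
theorem exists_drift (hM : ∀ v, 1 ≤ M v) {ε : ℝ≥0∞} (hε0 : ε ≠ 0) (hε : ε ≠ ⊤) (Λ : Finset V)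
    (hΛ : ∀ w ∈ Λ, ∑' l : ℕ+, ((S w l).card : ℝ≥0∞) * ψ w l ≠ ⊤)
    (hΛc : ∀ w ∉ Λ, ∑' l : ℕ+, ((S w l).card : ℝ≥0∞) * ψ w l + ε ≤ ψ w 0) :
    ∃ K : ℕ, ∀ A : Finset V, K < A.card →
      transOp (transProb M ψ S) (fun B => (B.card : ℝ≥0∞)) A + ε / 2 ≤ A.card := by
  set R : V → ℝ≥0∞ := fun w => ∑' l : ℕ+, ((S w l).card : ℝ≥0∞) * ψ w l
  set C : ℝ≥0∞ := ∑ w ∈ Λ, ENNReal.ofReal (M w) * (R w + ε)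
  have hC : C ≠ ⊤ := ENNReal.sum_ne_top.2 fun w hw =>
    ENNReal.mul_ne_top ENNReal.ofReal_ne_top (ENNReal.add_ne_top.2 ⟨hΛ w hw, hε⟩)
  have hε2 : ε / 2 ≠ 0 := (ENNReal.half_pos hε0).ne'
  obtain ⟨K, hK⟩ := ENNReal.exists_nat_mul_gt hε2 hC
  refine ⟨K, fun A hAK => ?_⟩
  have hA : A.Nonempty := Finset.card_pos.1 (Nat.zero_lt_of_lt hAK)
  have hA0 : (A.card : ℝ≥0∞) ≠ 0 := by exact_mod_cast hA.card_pos.ne'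
  set g : V → ℝ≥0∞ := fun w => if w ∈ Λ then R w + ε else 0
  have hstep : ∀ w ∈ A, updateMean ψ S (fun B => (B.card : ℝ≥0∞)) A w + ε ≤ A.card + g w := by
    intro w hw
    have hcard := updateMean_card_add_le (ψ := ψ) (S := S) hw
    by_cases hwΛ : w ∈ Λ
    · simp only [g, if_pos hwΛ, ← add_assoc]
      gcongr
      exact le_self_add.trans hcard
    · simp only [g, if_neg hwΛ, add_zero]
      have hR : R w ≠ ⊤ := ne_top_of_le_ne_top ((ψ w).apply_ne_top 0)
        (le_self_add.trans (hΛc w hwΛ))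
      refine (ENNReal.add_le_add_iff_right hR).1 (le_trans ?_ hcard)
      rw [add_assoc, add_comm ε]
      gcongr
      exact hΛc w hwΛ
  have herr : ∑ w ∈ A, selectProb M A w * g w ≤ ε / 2 := by
    have hmul : A.card * ∑ w ∈ A, selectProb M A w * g w ≤ A.card * (ε / 2) := by
      calc A.card * ∑ w ∈ A, selectProb M A w * g w
          = ∑ w ∈ A, A.card * selectProb M A w * g w := by simp only [Finset.mul_sum, mul_assoc]
        _ ≤ ∑ w ∈ A, ENNReal.ofReal (M w) * g w := by
          gcongr with w
          exact card_mul_selectProb_le hM hA w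
        _ = ∑ w ∈ A with w ∈ Λ, ENNReal.ofReal (M w) * (R w + ε) := by
          simp only [g, mul_ite, mul_zero, Finset.sum_filter]
        _ ≤ C := Finset.sum_le_sum_of_subset fun w hw => (Finset.mem_filter.1 hw).2
        _ ≤ K * (ε / 2) := hK.le
        _ ≤ A.card * (ε / 2) := by gcongr
    exact (ENNReal.mul_le_mul_iff_right hA0 (ENNReal.natCast_ne_top _)).1 hmul
  have hsum : transOp (transProb M ψ S) (fun B => (B.card : ℝ≥0∞)) A + ε / 2 + ε / 2 ≤
      A.card + ε / 2 := by
    rw [add_assoc, ENNReal.add_halves]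
    refine (transOp_transProb_add_le hM hA hstep).trans ?_
    simp only [mul_add, Finset.sum_add_distrib]
    rw [← Finset.sum_mul, sum_selectProb hM hA, one_mul]
    gcongr
  exact (ENNReal.add_le_add_iff_right (ENNReal.div_ne_top hε two_ne_zero)).1 hsum

theorem ae_eventually_eq_empty [Countable V] (hM : ∀ v, 1 ≤ M v) (hψ : ∀ v, 0 < ψ v 0)
    (hfin : ∀ v, eta ψ S v < ⊤) {r : ℝ} (hr : r < 0) (Λ : Finset V)
    (hΛ : ∀ v ∉ Λ, eta ψ S v ≤ r) {Ω : Type*} [MeasurableSpace Ω] {P : Measure Ω}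
    {ν : PMF (Finset V)} {D : ℕ → Ω → Finset V}
    (hD : IsMarkovChain P ν (transProb M ψ S) D) :
    ∀ᵐ ω ∂P, ∃ m, ∀ n ≥ m, D n ω = ∅ := by
  set ε := ENNReal.ofReal (-r)
  have hε : 0 < ε := ENNReal.ofReal_pos.2 (neg_pos.2 hr)
  have hΛc : ∀ w ∉ Λ, ∑' l : ℕ+, ((S w l).card : ℝ≥0∞) * ψ w l + ε ≤ ψ w 0 :=
    fun w hw => tsum_add_le_of_eta_le hr.le (hΛ w hw)
  obtain ⟨K, hK⟩ := exists_drift hM hε.ne' ENNReal.ofReal_ne_top Λ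
    (fun w _ => tsum_ne_top_of_eta_lt_top (hfin w)) hΛc
  -- Outside `Λ` the probability of drawing `0` is at least `ε`, as `η_w ≥ -ψ_w(0)`.
  set δ := min (min 1 ε) (Λ.inf fun v => ψ v 0)
  have hδ0 : 0 < δ := lt_min (lt_min one_pos hε)
    ((Finset.lt_inf_iff ENNReal.coe_lt_top).2 fun v _ => hψ v)
  have hδ1 : δ ≤ 1 := (min_le_left _ _).trans (min_le_left _ _)
  have hδ : ∀ v, δ ≤ ψ v 0 := by
    intro v
    by_cases hv : v ∈ Λ
    · exact (min_le_right _ _).trans (Finset.inf_le hv)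
    · exact ((min_le_left _ _).trans (min_le_right _ _)).trans (le_add_self.trans (hΛc v hv))
  exact hD.ae_eventually_eq (fun B hB => by simp [transProb, hB]) (antitone_iterate_transOp hM)
    (iInf_iterate_transOp_eq_zero hM hδ0.ne' hδ1 hδ (ENNReal.half_pos hε.ne').ne' K hK)

end Transition

end Extinction

theorem mainTheorem3 (d : ℕ)
    (M : (Fin d → ℤ) → ℝ) (hM : ∀ v, 1 ≤ M v)
    (ψ : (Fin d → ℤ) → PMF ℕ) (hψ : ∀ v, 0 < ψ v 0)
    (S : (Fin d → ℤ) → ℕ+ → Finset (Fin d → ℤ))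
    (hfin : ∀ v, Extinction.eta ψ S v < ⊤)
    (L : EReal)
    (hlim : Tendsto (fun Λ : Finset (Fin d → ℤ) => ⨆ v ∉ Λ, Extinction.eta ψ S v) atTop (𝓝 L))
    (hL : L < 0)
    {Ω : Type*} [MeasurableSpace Ω] (P : Measure Ω) [IsProbabilityMeasure P]
    (ν : PMF (Finset (Fin d → ℤ))) (D : ℕ → Ω → Finset (Fin d → ℤ))
    (hD : Extinction.IsMarkovChain P ν (Extinction.transProb M ψ S) D) :
    ∀ᵐ ω ∂P, limsup (fun n => (D n ω : Set (Fin d → ℤ))) atTop = ∅ ∧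
      ∃ m : ℕ, ∀ n ≥ m, D n ω = ∅ := by
  obtain ⟨r, hLr, hr⟩ := EReal.lt_iff_exists_real_btwn.1 hL
  obtain ⟨Λ, hΛ⟩ := (hlim.eventually_lt_const hLr).exists
  filter_upwards [Extinction.ae_eventually_eq_empty hM hψ hfin (EReal.coe_neg'.1 hr) Λ
    (fun v hv => (le_iSup₂ (f := fun v (_ : v ∉ Λ) => Extinction.eta ψ S v) v hv).trans hΛ.le) hD]
    with ω hω
  refine ⟨?_, hω⟩
  obtain ⟨m, hm⟩ := hω
  have hev : (fun n => (D n ω : Set (Fin d → ℤ))) =ᶠ[atTop] fun _ => ∅ := by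
    filter_upwards [eventually_ge_atTop m] with n hn
    rw [hm n hn, Finset.coe_empty]
  rw [limsup_congr hev, limsup_const]
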